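/- Let $\mathcal{C}$ be a category. A pro-object of $\mathcal{C}$ is a functor $X \colon I \to \mathcal{C}$, $s \mapsto X_s$, from a small cofiltered category $I$; pro-objects are the objects of the category $\mathrm{pro}\text{-}\mathcal{C}$, with $$\operatorname{Hom}_{\mathrm{pro}\text{-}\mathcal{C}}(X,Y) = \lim_s \operatorname{colim}_t \operatorname{Hom}_{\mathcal{C}}(X_t, Y_s)$$ and the evident composition. Let $C$ be any class of objects of $\mathcal{C}$. A pro-object is of type $C$ if each $X_s$ belongs to $C$, and it is essentially of type $C$ if it is isomorphic in $\mathrm{pro}\text{-}\mathcal{C}$ to a pro-object of type $C$. Theorem. The class of objects of $\mathrm{pro}\text{-}\mathcal{C}$ that are essentially of type $C$ is closed under retracts: if $Y$ is essentially of type $C$ and $f \colon X \to Y$, $g \colon Y \to X$ are morphisms of $\mathrm{pro}\text{-}\mathcal{C}$ with $gf = \mathrm{id}_X$, then $X$ is essentially of type $C$. -/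

import Mathlib

open CategoryTheory

universe w v u

/-- A pro-object of `C`: a diagram in `C` indexed by a small cofiltered category, where "small"
means that objects and morphisms of the index category form types in `Type w`. -/
structure ProObject (C : Type u) [Category.{v} C] where
  /-- The index category. -/
  I : Type w
  [smallCategory : SmallCategory I]
  [isCofiltered : IsCofiltered I]
  /-- The underlying diagram. -/
  diagram : I ⥤ C

namespace ProObject

attribute [instance] ProObject.smallCategory ProObject.isCofiltered

variable {C : Type u} [Category.{v} C]

/-- The set `colim_t Hom_C (X_t, A)`, for a pro-object `X` and an object `A` of `C`. -/
def ColimHom (X : ProObject.{w} C) (A : C) : Type (max w v) :=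
  (X.diagram.op ⋙ yoneda.obj A).ColimitType

namespace ColimHom

/-- The class in `colim_t Hom_C (X_t, A)` of a morphism `a : X_t ⟶ A`. -/
def mk {X : ProObject.{w} C} {A : C} (t : X.I) (a : X.diagram.obj t ⟶ A) : X.ColimHom A :=
  (X.diagram.op ⋙ yoneda.obj A).ιColimitType (Opposite.op t) a

theorem exists_mk {X : ProObject.{w} C} {A : C} (x : X.ColimHom A) :
    ∃ (t : X.I) (a : X.diagram.obj t ⟶ A), mk t a = x := by
  obtain ⟨t, a, h⟩ := (X.diagram.op ⋙ yoneda.obj A).ιColimitType_jointly_surjective x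
  exact ⟨t.unop, a, h⟩

theorem mk_map {X : ProObject.{w} C} {A : C} {t t' : X.I} (p : t' ⟶ t)
    (a : X.diagram.obj t ⟶ A) : mk t' (X.diagram.map p ≫ a) = mk t a :=
  (X.diagram.op ⋙ yoneda.obj A).ιColimitType_map p.op a

/-- The map out of `colim_t Hom_C (X_t, A)` induced by a compatible family of maps. -/
def desc {X : ProObject.{w} C} {A : C} {T : Type*} (φ : ∀ t : X.I, (X.diagram.obj t ⟶ A) → T)
    (hφ : ∀ {t t' : X.I} (p : t' ⟶ t) (a : X.diagram.obj t ⟶ A),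
      φ t' (X.diagram.map p ≫ a) = φ t a) : X.ColimHom A → T :=
  (X.diagram.op ⋙ yoneda.obj A).descColimitType
    { pt := T
      ι := fun t a => φ t.unop a
      ι_naturality := fun p => funext fun a => hφ p.unop a }

theorem desc_mk {X : ProObject.{w} C} {A : C} {T : Type*}
    (φ : ∀ t : X.I, (X.diagram.obj t ⟶ A) → T)
    (hφ : ∀ {t t' : X.I} (p : t' ⟶ t) (a : X.diagram.obj t ⟶ A),
      φ t' (X.diagram.map p ≫ a) = φ t a) (t : X.I) (a : X.diagram.obj t ⟶ A) :
    desc φ hφ (mk t a) = φ t a := rfl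

/-- Functoriality of `colim_t Hom_C (X_t, A)` in `A`. -/
def postcomp {X : ProObject.{w} C} {A B : C} (x : X.ColimHom A) (b : A ⟶ B) : X.ColimHom B :=
  desc (fun t a => mk t (a ≫ b)) (fun p a => by rw [Category.assoc, mk_map]) x

theorem postcomp_mk {X : ProObject.{w} C} {A B : C} (t : X.I) (a : X.diagram.obj t ⟶ A)
    (b : A ⟶ B) : (mk t a).postcomp b = mk t (a ≫ b) := rfl

theorem postcomp_comp {X : ProObject.{w} C} {A B D : C} (x : X.ColimHom A) (b : A ⟶ B)
    (d : B ⟶ D) : x.postcomp (b ≫ d) = (x.postcomp b).postcomp d := by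
  obtain ⟨t, a, rfl⟩ := exists_mk x
  simp only [postcomp_mk, Category.assoc]

end ColimHom

/-- Morphisms of pro-objects: an element of `lim_s colim_t Hom_C (X_t, Y_s)`, that is, a family of
elements of the sets `colim_t Hom_C (X_t, Y_s)` compatible with the structure maps of `Y`. -/
@[ext]
structure Hom (X Y : ProObject.{w} C) where
  /-- The component in `colim_t Hom_C (X_t, Y_s)`. -/
  app (s : Y.I) : X.ColimHom (Y.diagram.obj s)
  naturality {s s' : Y.I} (q : s' ⟶ s) : (app s').postcomp (Y.diagram.map q) = app s

namespace Hom

/-- The map `colim_s Hom_C (Y_s, A) → colim_t Hom_C (X_t, A)` induced by `f : X → Y`. It sends the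
class of `b : Y_s ⟶ A` to the class of `a ≫ b`, where `a : X_t ⟶ Y_s` represents `f`. -/
def pull {X Y : ProObject.{w} C} (f : Hom X Y) {A : C} : Y.ColimHom A → X.ColimHom A :=
  ColimHom.desc (fun s b => (f.app s).postcomp b)
    (fun q b => by rw [ColimHom.postcomp_comp, f.naturality])

theorem pull_mk {X Y : ProObject.{w} C} (f : Hom X Y) {A : C} (s : Y.I)
    (b : Y.diagram.obj s ⟶ A) : f.pull (ColimHom.mk s b) = (f.app s).postcomp b := rfl

theorem pull_postcomp {X Y : ProObject.{w} C} (f : Hom X Y) {A B : C} (y : Y.ColimHom A)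
    (b : A ⟶ B) : f.pull (y.postcomp b) = (f.pull y).postcomp b := by
  obtain ⟨s, a, rfl⟩ := ColimHom.exists_mk y
  rw [ColimHom.postcomp_mk, pull_mk, pull_mk, ColimHom.postcomp_comp]

/-- The identity, represented by the identities of the objects `X_s`. -/
def id (X : ProObject.{w} C) : Hom X X where
  app s := ColimHom.mk s (𝟙 _)
  naturality q := by
    rw [ColimHom.postcomp_mk, Category.id_comp, ← ColimHom.mk_map q, Category.comp_id]

/-- Composition: if `a : X_t ⟶ Y_s` represents `f` and `b : Y_s ⟶ Z_r` represents `g`, then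
`a ≫ b` represents the composite. -/
def comp {X Y Z : ProObject.{w} C} (f : Hom X Y) (g : Hom Y Z) : Hom X Z where
  app r := f.pull (g.app r)
  naturality q := by rw [← pull_postcomp, g.naturality]

theorem pull_comp {X Y Z : ProObject.{w} C} (f : Hom X Y) (g : Hom Y Z) {A : C}
    (z : Z.ColimHom A) : (f.comp g).pull z = f.pull (g.pull z) := by
  obtain ⟨r, a, rfl⟩ := ColimHom.exists_mk z
  rw [pull_mk, pull_mk, pull_postcomp]
  rfl

theorem pull_id {X : ProObject.{w} C} {A : C} (x : X.ColimHom A) : (Hom.id X).pull x = x := by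
  obtain ⟨r, a, rfl⟩ := ColimHom.exists_mk x
  rw [pull_mk]
  exact congrArg (ColimHom.mk r) (Category.id_comp a)

end Hom

/-- The pro-category of `C`. -/
instance : Category (ProObject.{w} C) where
  Hom := Hom
  id := Hom.id
  comp := Hom.comp
  id_comp f := by
    ext s
    exact Hom.pull_id _
  comp_id f := by
    ext s
    obtain ⟨t, a, h⟩ := ColimHom.exists_mk (f.app s)
    change (f.app s).postcomp (𝟙 _) = f.app s
    rw [← h, ColimHom.postcomp_mk, Category.comp_id]
  assoc f g h := by
    ext s
    exact Hom.pull_comp f g _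

/-- A pro-object `X` is of type `P` if each `X_s` belongs to `P`. -/
def IsOfType (P : ObjectProperty C) (X : ProObject.{w} C) : Prop :=
  ∀ s : X.I, P (X.diagram.obj s)

/-- A pro-object is essentially of type `P` if it is isomorphic, in the pro-category, to a
pro-object of type `P`. -/
def essentiallyOfType (P : ObjectProperty C) : ObjectProperty (ProObject.{w} C) :=
  fun X => ∃ Y : ProObject.{w} C, Y.IsOfType P ∧ Nonempty (X ≅ Y)

end ProObject

namespace ProObject

variable {C : Type u} [Category.{v} C]

/-! After replacing Y by an isomorphic pro-object of type P, X splits the idempotent e = gf (f then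
g reversed: Y → X → Y) of Y, so it suffices to split e by a pro-object made of the objects Y_s.
Choose for each s a map of C from some Y_t to Y_s representing e. Keep the objects Y_s, but take as
transition maps the composites of these representatives with structure maps. Since e is idempotent,
a representative followed by any such composite still represents e (`Word.mk_comp_eval`). Two
parallel composites therefore agree after precomposition with a representative and a structure map,
so the new index category is cofiltered. In its pro-object each representative is a transition map,
so e becomes the identity there. -/

theorem ColimHom.mk_eq_mk_iff {X : ProObject.{w} C} {A : C} {t t' : X.I}
    (a : X.diagram.obj t ⟶ A) (a' : X.diagram.obj t' ⟶ A) :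
    mk t a = mk t' a' ↔
      ∃ (k : X.I) (p : k ⟶ t) (p' : k ⟶ t'), X.diagram.map p ≫ a = X.diagram.map p' ≫ a' := by
  constructor
  · intro h
    obtain ⟨k, p, p', hp⟩ :=
      ((X.diagram.op ⋙ yoneda.obj A).ιColimitType_eq_iff_of_isFiltered a a').1 h
    exact ⟨k.unop, p.unop, p'.unop, hp⟩
  · rintro ⟨k, p, p', h⟩
    rw [← mk_map p a, h, mk_map]

/-- The data needed to represent an endomorphism of `Y`: for each index `s`, a morphism from some
`Y_t` to `Y_s`. -/
structure EndoRep (Y : ProObject.{w} C) where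
  /-- The index of the source of the representative. -/
  source : Y.I → Y.I
  /-- The representative. -/
  map (s : Y.I) : Y.diagram.obj (source s) ⟶ Y.diagram.obj s

namespace EndoRep

variable {Y : ProObject.{w} C}

/-- `ρ.Represents e` means that the morphisms of `ρ` represent the components of `e`. -/
def Represents (ρ : EndoRep Y) (e : Y ⟶ Y) : Prop :=
  ∀ s, ColimHom.mk (ρ.source s) (ρ.map s) = e.app s

theorem exists_represents (e : Y ⟶ Y) : ∃ ρ : EndoRep Y, ρ.Represents e := by
  choose t a h using fun s => ColimHom.exists_mk (e.app s)
  exact ⟨⟨t, a⟩, h⟩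

/-! ### Words in the representatives -/

/-- Formal composites of representatives in `ρ`, pre- and postcomposed with structure maps. -/
inductive Word (ρ : EndoRep Y) : Y.I → Y.I → Type w
  | nil (s : Y.I) : Word ρ s s
  | cons {s u u' r : Y.I} (p : s ⟶ ρ.source u) (q : u ⟶ u') (l : Word ρ u' r) : Word ρ s r

namespace Word

variable {ρ : EndoRep Y}

/-- The morphism of `C` described by a word. -/
def eval : {s r : Y.I} → Word ρ s r → (Y.diagram.obj s ⟶ Y.diagram.obj r)
  | _, _, nil _ => 𝟙 _
  | _, _, cons (u := u) p q l => (Y.diagram.map p ≫ ρ.map u ≫ Y.diagram.map q) ≫ l.eval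

/-- Concatenation of words. -/
def append {s r t : Y.I} : Word ρ s r → Word ρ r t → Word ρ s t
  | nil _, m => m
  | cons p q l, m => cons p q (l.append m)

theorem eval_append {s r t : Y.I} (l : Word ρ s r) (m : Word ρ r t) :
    (l.append m).eval = l.eval ≫ m.eval := by
  induction l with
  | nil => simp [append, eval]
  | cons p q l ih => simp [append, eval, ih]

/-- The idempotent `e` absorbs words in its representatives. -/
theorem mk_comp_eval {e : Y ⟶ Y} (he : e ≫ e = e) (hρ : ρ.Represents e) {s r : Y.I}
    (l : Word ρ s r) {t : Y.I} (a : Y.diagram.obj t ⟶ Y.diagram.obj s)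
    (ha : ColimHom.mk t a = e.app s) : ColimHom.mk t (a ≫ l.eval) = e.app r := by
  induction l generalizing t with
  | nil => simpa [eval] using ha
  | @cons s u u' r p q l ih =>
    have key : ColimHom.mk s (Y.diagram.map p ≫ ρ.map u ≫ Y.diagram.map q) = e.app u' := by
      rw [ColimHom.mk_map, ← ColimHom.postcomp_mk, hρ u, e.naturality]
    rw [eval, ← Category.assoc]
    refine ih _ ?_
    rw [← ColimHom.postcomp_mk, ha, ← Hom.pull_mk, key]
    exact congrArg (fun f : Y ⟶ Y => f.app u') he

/-- The components of a morphism fixed by `e` are compatible with words in the representatives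
of `e`. -/
theorem postcomp_eval {X : ProObject.{w} C} {f : X ⟶ Y} {e : Y ⟶ Y} (hf : f ≫ e = f)
    (hρ : ρ.Represents e) {s r : Y.I} (l : Word ρ s r) :
    (f.app s).postcomp l.eval = f.app r := by
  induction l with
  | nil s => rw [Word.eval, ← Y.diagram.map_id, f.naturality]
  | @cons s u u' r p q l ih =>
    rw [Word.eval, ColimHom.postcomp_comp, ← ih, ← Hom.pull_mk, ColimHom.mk_map,
      ← ColimHom.postcomp_mk, hρ u, e.naturality]
    exact congrArg (fun g : X ⟶ Y => (g.app u').postcomp l.eval) hf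

end Word

/-! ### The new index category -/

/-- The indices of `Y`, with the morphisms of `C` that are composites of the representatives. -/
structure Index (ρ : EndoRep Y) : Type w where
  /-- The underlying index of `Y`. -/
  idx : Y.I

namespace Index

variable {ρ : EndoRep Y}

/-- Arrows are values of words, so their equality is tested in C. A structure map of Y need not be
an arrow. -/
instance : Category.{v} ρ.Index where
  Hom s r := {a : Y.diagram.obj s.idx ⟶ Y.diagram.obj r.idx // ∃ l : Word ρ s.idx r.idx, l.eval = a}
  id s := ⟨𝟙 _, .nil _, rfl⟩
  comp a b := ⟨a.1 ≫ b.1, by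
    obtain ⟨_, l, rfl⟩ := a
    obtain ⟨_, m, rfl⟩ := b
    exact ⟨l.append m, l.eval_append m⟩⟩
  id_comp a := Subtype.ext (Category.id_comp a.1)
  comp_id a := Subtype.ext (Category.comp_id a.1)
  assoc a b c := Subtype.ext (Category.assoc a.1 b.1 c.1)

/-- Homs of C may be too large for an index category, but words form a type in `Type w`. -/
instance : LocallySmall.{w} ρ.Index where
  hom_small s r :=
    small_of_surjective (α := Word ρ s.idx r.idx) (f := fun l => ⟨l.eval, l, rfl⟩)
      (by rintro ⟨_, l, rfl⟩; exact ⟨l, rfl⟩)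

/-- The morphism of `ρ.Index` given by a representative, precomposed and postcomposed with
structure maps of `Y`. -/
def step {s u u' : Y.I} (p : s ⟶ ρ.source u) (q : u ⟶ u') : (⟨s⟩ : ρ.Index) ⟶ ⟨u'⟩ :=
  ⟨Y.diagram.map p ≫ ρ.map u ≫ Y.diagram.map q, .cons p q (.nil _), by simp [Word.eval]⟩

variable (ρ) in
/-- The inclusion in `C`. -/
def toBase : ρ.Index ⥤ C where
  obj s := Y.diagram.obj s.idx
  map a := a.1
  map_id _ := rfl
  map_comp _ _ := rfl

theorem isCofiltered {e : Y ⟶ Y} (he : e ≫ e = e) (hρ : ρ.Represents e) :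
    IsCofiltered ρ.Index where
  nonempty := ⟨⟨(IsCofiltered.nonempty (C := Y.I)).some⟩⟩
  cone_objs s r :=
    ⟨⟨IsCofiltered.min (ρ.source s.idx) (ρ.source r.idx)⟩,
      step (IsCofiltered.minToLeft _ _) (𝟙 s.idx), step (IsCofiltered.minToRight _ _) (𝟙 r.idx),
      trivial⟩
  cone_maps s r := by
    rintro ⟨_, l, rfl⟩ ⟨_, m, rfl⟩
    obtain ⟨k, p, p', h⟩ := (ColimHom.mk_eq_mk_iff _ _).1
      ((l.mk_comp_eval he hρ _ (hρ s.idx)).trans (m.mk_comp_eval he hρ _ (hρ s.idx)).symm)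
    -- The legs p and p' may differ; equalizing them in Y.I lets a single arrow precede both words.
    refine ⟨⟨IsCofiltered.eq p p'⟩, step (IsCofiltered.eqHom p p' ≫ p) (𝟙 s.idx),
      Subtype.ext ?_⟩
    change (Y.diagram.map (IsCofiltered.eqHom p p' ≫ p) ≫ ρ.map s.idx ≫ Y.diagram.map (𝟙 _)) ≫
      l.eval = (Y.diagram.map (IsCofiltered.eqHom p p' ≫ p) ≫ ρ.map s.idx ≫
        Y.diagram.map (𝟙 _)) ≫ m.eval
    conv_rhs => rw [IsCofiltered.eq_condition p p']
    simp [h]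

end Index

/-! ### Splitting the idempotent -/

section Splitting

variable (ρ : EndoRep Y) {e : Y ⟶ Y} (he : e ≫ e = e) (hρ : ρ.Represents e)

/-- The pro-object that splits the idempotent `e` of `Y` represented by `ρ`. It consists of the
same objects of `C` as `Y`. -/
noncomputable def splitting : ProObject.{w} C :=
  have := Index.isCofiltered he hρ
  have := IsCofiltered.of_equivalence (ShrinkHoms.equivalence.{w} ρ.Index)
  { I := ShrinkHoms.{w} ρ.Index
    diagram := ShrinkHoms.inverse ρ.Index ⋙ Index.toBase ρ }

/-- The class in `colim_s Hom_C (Y_s, A)`, taken over the index category of the splitting, of a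
morphism `Y_s ⟶ A`. -/
noncomputable def splittingMk {A : C} (s : Y.I) (a : Y.diagram.obj s ⟶ A) :
    (ρ.splitting he hρ).ColimHom A :=
  ColimHom.mk (X := ρ.splitting he hρ) (ShrinkHoms.toShrinkHoms (⟨s⟩ : ρ.Index)) a

theorem splittingMk_hom {A : C} {s r : Y.I} (φ : (⟨s⟩ : ρ.Index) ⟶ ⟨r⟩)
    (a : Y.diagram.obj r ⟶ A) :
    ρ.splittingMk he hρ s (φ.1 ≫ a) = ρ.splittingMk he hρ r a := by
  have h := ColimHom.mk_map (X := ρ.splitting he hρ)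
    ((ShrinkHoms.functor.{w} ρ.Index).map φ) (A := A) a
  have h' : (ρ.splitting he hρ).diagram.map ((ShrinkHoms.functor.{w} ρ.Index).map φ) = φ.1 :=
    congrArg Subtype.val ((equivShrink _).symm_apply_apply φ)
  rw [h'] at h
  exact h

theorem splittingMk_step {A : C} {s u u' : Y.I} (p : s ⟶ ρ.source u) (q : u ⟶ u')
    (a : Y.diagram.obj u' ⟶ A) :
    ρ.splittingMk he hρ s (Y.diagram.map p ≫ ρ.map u ≫ Y.diagram.map q ≫ a) =
      ρ.splittingMk he hρ u' a := by
  have h := ρ.splittingMk_hom he hρ (Index.step p q) a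
  simpa only [Index.step, Category.assoc] using h

/-- Although q need not give an arrow of the new index category, both classes equal that of `ρ.map
s'` followed by q and a. -/
theorem splittingMk_map {A : C} {s s' : Y.I} (q : s' ⟶ s) (a : Y.diagram.obj s ⟶ A) :
    ρ.splittingMk he hρ s' (Y.diagram.map q ≫ a) = ρ.splittingMk he hρ s a := by
  rw [← ρ.splittingMk_step he hρ (𝟙 _) (𝟙 s'), ← ρ.splittingMk_step he hρ (𝟙 _) q a]
  simp

/-- The inclusion of the splitting in `Y`. -/
noncomputable def splittingι : ρ.splitting he hρ ⟶ Y where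
  app s := ρ.splittingMk he hρ s (𝟙 _)
  naturality {s s'} q := by
    rw [← ρ.splittingMk_map he hρ q]
    change ρ.splittingMk he hρ s' (𝟙 _ ≫ Y.diagram.map q) = _
    rw [Category.id_comp, Category.comp_id]

theorem splittingι_pull_mk {A : C} (s : Y.I) (a : Y.diagram.obj s ⟶ A) :
    (ρ.splittingι he hρ).pull (ColimHom.mk s a) = ρ.splittingMk he hρ s a :=
  congrArg (ρ.splittingMk he hρ s) (Category.id_comp a)

/-- The lift to the splitting of a morphism that is fixed by the idempotent. -/
noncomputable def splittingLift {X : ProObject.{w} C} (f : X ⟶ Y) (hf : f ≫ e = f) :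
    X ⟶ ρ.splitting he hρ where
  app s := f.app (ShrinkHoms.fromShrinkHoms s).idx
  naturality {s s'} q := by
    obtain ⟨l, hl⟩ := ((ShrinkHoms.inverse ρ.Index).map q).2
    refine Eq.trans ?_ (l.postcomp_eval hf hρ)
    rw [hl]
    rfl

theorem splittingLift_ι {X : ProObject.{w} C} (f : X ⟶ Y) (hf : f ≫ e = f) :
    ρ.splittingLift he hρ f hf ≫ ρ.splittingι he hρ = f := by
  apply Hom.ext
  funext s
  change (f.app s).postcomp (𝟙 _) = f.app s
  rw [← Y.diagram.map_id, f.naturality]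

/-- The component at s is the class of `ρ.map s`, which is a transition map and hence has the class
of the identity. -/
theorem splittingι_comp_lift :
    ρ.splittingι he hρ ≫ ρ.splittingLift he hρ e he = 𝟙 _ := by
  apply Hom.ext
  funext s
  change (ρ.splittingι he hρ).pull (e.app (ShrinkHoms.fromShrinkHoms s).idx) =
    ρ.splittingMk he hρ (ShrinkHoms.fromShrinkHoms s).idx (𝟙 _)
  rw [← hρ, splittingι_pull_mk]
  refine Eq.trans ?_ (ρ.splittingMk_step he hρ (𝟙 _) (𝟙 _) (𝟙 _))
  simp

end Splitting

end EndoRep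

/-- A retract of a pro-object of type `P` is isomorphic to a pro-object of type `P`. -/
theorem IsOfType.essentiallyOfType_of_retract {P : ObjectProperty C} {X Y : ProObject.{w} C}
    (hY : Y.IsOfType P) (h : Retract X Y) : essentiallyOfType P X := by
  have he : (h.r ≫ h.i) ≫ h.r ≫ h.i = h.r ≫ h.i := by simp
  have hi : h.i ≫ h.r ≫ h.i = h.i := by simp
  obtain ⟨ρ, hρ⟩ := EndoRep.exists_represents (h.r ≫ h.i)
  refine ⟨ρ.splitting he hρ, fun s => hY (ShrinkHoms.fromShrinkHoms s).idx,
    ⟨ρ.splittingLift he hρ h.i hi, ρ.splittingι he hρ ≫ h.r, ?_, ?_⟩⟩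
  · rw [← Category.assoc, ρ.splittingLift_ι he hρ, h.retract]
  · rw [Category.assoc, ← ρ.splittingι_comp_lift he hρ]
    -- The lift only reindexes components, so `h.r` followed by the lift of `h.i` is the lift of
    -- `h.r ≫ h.i`.
    rfl

end ProObject

/-- For every class `P` of objects of a category `C`, the class of pro-objects of `C` that are
essentially of type `P` is closed under retracts. -/
theorem theorem5p5 {C : Type u} [Category.{v} C] (P : ObjectProperty C) :
    (ProObject.essentiallyOfType.{w} P).IsStableUnderRetracts where
  of_retract h := by
    rintro ⟨Z, hZ, ⟨φ⟩⟩
    exact hZ.essentiallyOfType_of_retract (h.trans (.ofIso φ))
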